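/- Let $d\ge 1$ be an integer and $\beta>0$. For $N\in\mathbb N$ let $G(N)$ be the random graph on the box $[N]^d:=\{0,1,\dots,N\}^d$ in which each pair of distinct sites $x,y$ is joined by an edge, independently of the other pairs, with probability $1$ if $\|x-y\|_1=1$ and $1-\exp(-\beta/\|x-y\|_1^{d})$ otherwise. Let $D$ be the graph distance of $G(N)$. For a nonempty deterministic set $B_0\subseteq[N]^d$ put $B_m:=\{y\in[N]^d: D(x,y)\le m\text{ for some }x\in B_0\}$ for $m\ge 0$, $B_{-1}:=\emptyset$ and $\partial B_m:=B_m\setminus B_{m-1}$. (i) There is a constant $C=C(\beta,d)\in(0,\infty)$ such that for each $\alpha\in(0,1)$ there are constants $c_1,c_2\in(0,\infty)$ depending only on $\beta,d,\alpha$ such that for each $K\in\mathbb N$ there is $N_*=N_*(\beta,d,\alpha,K)$ with the following property: for all $N\ge N_*$, all nonempty $B_0\subseteq[N]^d$ with $|B_0|\le K$ and all integers $m$ with $0\le m\le \frac{\alpha d\log N}{\log\log N}$, $$\mathbb P\Bigl((c_1\log N)^m\le \frac{|\partial B_m|}{|B_0|}\le (C\log N)^m\Bigr)\ \ge\ 1-2\exp\bigl(-c_2\log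 N\cdot|B_0|\bigr).$$ (ii) There is a constant $C=C(\beta,d)\in(0,\infty)$ such that for each $\alpha\in(0,1)$ there are constants $c_1,c_2\in(0,\infty)$ depending only on $\beta,d,\alpha$ such that for each $K\in\mathbb N$ there is $N_*=N_*(\beta,d,\alpha,K)$ with the following property: for all $N\ge N_*$, all nonempty $B_0\subseteq[N]^d$ with $|B_0|\le K$ and $m=\bigl\lfloor\frac{\alpha d\log N}{\log\log N}\bigr\rfloor$, $$\mathbb P\Bigl(N^{\alpha d(1-c_1/\log\log N)}\le \frac{|\partial B_m|}{|B_0|}\le N^{\alpha d(1+C/\log\log N)}\Bigr)\ \ge\ 1-2N^{-c_2|B_0|}.$$ The constants in (ii) need not be those in (i). -/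

import Mathlib

open MeasureTheory

/-- The sites of the box `{0, 1, …, N}^d`. -/
abbrev Site (d N : ℕ) : Type := Fin d → Fin (N + 1)

/-- The `ℓ¹`-distance `‖x - y‖` of two sites. -/
def l1Dist {d N : ℕ} (x y : Site d N) : ℕ :=
  ∑ i, (((x i : ℕ) : ℤ) - ((y i : ℕ) : ℤ)).natAbs

theorem l1Dist_comm {d N : ℕ} (x y : Site d N) : l1Dist x y = l1Dist y x := by
  unfold l1Dist
  refine Finset.sum_congr rfl fun i _ => ?_
  omega

/-- The connection probability of the unordered pair `{x, y}`: it is `1` for nearest neighbours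
and `1 - exp (-β / ‖x - y‖ ^ d)` otherwise. -/
noncomputable def connProb {d N : ℕ} (β : ℝ) (e : Sym2 (Site d N)) : ℝ :=
  Sym2.lift ⟨fun x y => if l1Dist x y = 1 then 1 else 1 - Real.exp (-(β / (l1Dist x y : ℝ) ^ d)),
    fun x y => by simp only [l1Dist_comm x y]⟩ e

theorem connProb_mem {d N : ℕ} {β : ℝ} (hβ : 0 ≤ β) (e : Sym2 (Site d N)) :
    0 ≤ connProb β e ∧ connProb β e ≤ 1 := by
  induction e with
  | h x y =>
    simp only [connProb, Sym2.lift_mk]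
    split_ifs
    · exact ⟨zero_le_one, le_rfl⟩
    · refine ⟨?_, by linarith [Real.exp_pos (-(β / (l1Dist x y : ℝ) ^ d))]⟩
      have h : Real.exp (-(β / (l1Dist x y : ℝ) ^ d)) ≤ 1 :=
        Real.exp_le_one_iff.2 (neg_nonpos.2 (by positivity))
      linarith

/-- The pairs of distinct sites, i.e. the potential edges. -/
abbrev SitePair (d N : ℕ) : Type := {e : Sym2 (Site d N) // ¬ e.IsDiag}

/-- An edge configuration tells for each pair of distinct sites whether it is open. -/
abbrev Config (d N : ℕ) : Type := SitePair d N → Bool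

/-- The law of long-range percolation on `{0, …, N}^d` with parameter `β`: the pairs of distinct
sites are open independently, each with its connection probability
(which lies in `[0, 1]` for `β ≥ 0`, by `connProb_mem`, so that
the projection onto `[0, 1]` only serves to change its type). -/
noncomputable def lrpLaw (d N : ℕ) (β : ℝ) : Measure (Config d N) :=
  Measure.pi fun e =>
    ProbabilityTheory.bernoulliMeasure true false (Set.projIcc (0 : ℝ) 1 zero_le_one (connProb β e.1))

instance isProbabilityMeasure_lrpLaw {d N : ℕ} {β : ℝ} : IsProbabilityMeasure (lrpLaw d N β) := by
  unfold lrpLaw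
  infer_instance

/-- The graph whose edges are the open pairs of the configuration `ω`. -/
def lrpGraph {d N : ℕ} (ω : Config d N) : SimpleGraph (Site d N) :=
  SimpleGraph.fromEdgeSet {e | ∃ h : ¬ e.IsDiag, ω ⟨e, h⟩ = true}

/-- The `m`-step expansion `B_m(U)`: the sites at graph distance at most `m` from some site of `U`.
The extended distance is used, so that sites in different components are at distance `⊤`. -/
def expansion {V : Type*} (G : SimpleGraph V) (U : Set V) (m : ℕ) : Set V :=
  {y | ∃ x ∈ U, G.edist x y ≤ m}

/-- The boundary `∂B_m(U) = B_m(U) \ B_{m-1}(U)`, with the convention `B_{-1}(U) = ∅`. -/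
def expansionBoundary {V : Type*} (G : SimpleGraph V) (U : Set V) : ℕ → Set V
  | 0 => expansion G U 0
  | m + 1 => expansion G U (m + 1) \ expansion G U m

/-- The ratio `|∂B_m(U)| / |U|` in the random graph of the configuration `ω`. -/
noncomputable def boundaryRatio {d N : ℕ} (U : Set (Site d N)) (m : ℕ) (ω : Config d N) : ℝ :=
  ((expansionBoundary (lrpGraph ω) U m).ncard : ℝ) / (U.ncard : ℝ)

open ProbabilityTheory

/-! ### Functions of disjoint sets of coordinates under a product measure -/

/-! The layers `∂B_k` are revealed one at a time, and each is larger than its predecessor by a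
factor of order `log N`. Since `∑_y 1 / ‖x - y‖ ^ d` is of order `log N` (`sum_one_div_l1Dist_le`,
`le_sum_one_div_l1Dist`), a layer `S` has at most of order `|S| log N` new neighbours on average.
For the converse, let `A` be the explored set and discard pairs at distance below `R ≈ N ^ ((1 + α)
/ 2)`. The remaining sum is still of order `(1 - α) log N`. If `β |A| ≤ R ^ d`, the long edges from
a site to `A` have expected number at most `1`. Hence `A` absorbs only a bounded part of each sum,
and multiple connections to one site cost only a constant factor (`le_sum_adjEvent`).

The events that `y ∉ A` is adjacent to `S` use disjoint sets of pairs for different `y`, so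
Chernoff's bound controls the size of the next layer (`lrpLaw_newSites_le`). The event that the
exploration has reached `(A, S)` does not depend on the pairs between `S` and `Aᶜ`, so the bound
persists after any history (`lrpLaw_exploration_step_le`). A union bound over the steps gives (i)
(`lrpLaw_growth_le`, `eventually_boundaryRatio`). The restriction on `m` keeps the explored set
below the size `R ^ d / β`. Part (ii) is (i) at the largest admissible `m`, where `(c log N) ^ m` is
rewritten as a power of `N`. -/

theorem exists_comp_of_dependsOn {ι X β : Type*} [Nonempty X] {f : (ι → X) → β} {s : Set ι}
    [Fintype s] (hf : DependsOn f s) :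
    ∃ f' : (s.toFinset → X) → β, f = f' ∘ fun a (i : s.toFinset) => a i := by
  classical
  refine ⟨fun a => f fun i => if h : i ∈ s.toFinset then a ⟨i, h⟩ else Classical.arbitrary X, ?_⟩
  funext a
  refine hf fun i hi => ?_
  simp [hi]

/-- Both functions factor through restrictions to disjoint finite blocks of independent coordinates;
finiteness of `X` makes the factors measurable. The factorization fills the other coordinates with a
default value, so empty `X` is treated separately. -/
theorem indepFun_pi_of_dependsOn {ι X β γ : Type*} [Fintype ι] [Finite X] [MeasurableSpace X]
    [DiscreteMeasurableSpace X] [MeasurableSpace β] [MeasurableSpace γ] (μ : ι → Measure X)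
    [∀ i, IsProbabilityMeasure (μ i)] {f : (ι → X) → β} {g : (ι → X) → γ} {s t : Set ι}
    (hf : DependsOn f s) (hg : DependsOn g t) (hst : Disjoint s t) :
    IndepFun f g (Measure.pi μ) := by
  classical
  cases isEmpty_or_nonempty X with
  | inl hX =>
    cases isEmpty_or_nonempty ι with
    | inl hι =>
      have h1 : f = fun _ => f isEmptyElim := funext fun x => by rw [Subsingleton.elim x]
      rw [h1]
      exact indepFun_const_left _ _
    | inr hι =>
      obtain ⟨i⟩ := hι
      have := nonempty_of_isProbabilityMeasure (μ i)
      exact (hX.false this.some).elim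
  | inr hX =>
  have ind : iIndepFun (fun (i : ι) (ω : ι → X) => ω i) (Measure.pi μ) :=
    iIndepFun_pi (X := fun _ x => x) fun i => aemeasurable_id
  have h := ind.indepFun_finset s.toFinset t.toFinset
    (by rwa [Set.disjoint_toFinset]) fun i => measurable_pi_apply i
  obtain ⟨f', hf'⟩ := exists_comp_of_dependsOn hf
  obtain ⟨g', hg'⟩ := exists_comp_of_dependsOn hg
  rw [hf', hg']
  exact h.comp (measurable_of_finite _) (measurable_of_finite _)

/-- Chernoff's bound on the moment generating function of a number of successes, for events that
depend on disjoint sets of coordinates. -/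
theorem mgf_sum_indicator_le {ι X J : Type*} [Fintype ι] [Finite X] [MeasurableSpace X]
    [DiscreteMeasurableSpace X] (μ : ι → Measure X) [∀ i, IsProbabilityMeasure (μ i)]
    (E : J → Set (ι → X)) (s : J → Set ι) (J₀ : Finset J)
    (hE : ∀ j ∈ J₀, DependsOn (· ∈ E j) (s j))
    (hs : (J₀ : Set J).PairwiseDisjoint s) (t : ℝ) :
    mgf (fun ω => ∑ j ∈ J₀, (E j).indicator (fun _ => (1 : ℝ)) ω) (Measure.pi μ) t ≤
      Real.exp ((Real.exp t - 1) * ∑ j ∈ J₀, (Measure.pi μ).real (E j)) := by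
  classical
  have hdep : ∀ j ∈ J₀, DependsOn ((E j).indicator (fun _ => (1 : ℝ))) (s j) := by
    intro j hj x y hxy
    have h : (x ∈ E j) = (y ∈ E j) := hE j hj hxy
    by_cases hx : x ∈ E j
    · rw [Set.indicator_of_mem hx, Set.indicator_of_mem (h ▸ hx)]
    · rw [Set.indicator_of_notMem hx, Set.indicator_of_notMem (h ▸ hx)]
  induction J₀ using Finset.induction_on with
  | empty => simp [mgf]
  | insert j J₁ hj ih =>
    have h1 : IndepFun ((E j).indicator (fun _ => (1 : ℝ)))
        (fun ω => ∑ i ∈ J₁, (E i).indicator (fun _ => (1 : ℝ)) ω) (Measure.pi μ) := by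
      refine indepFun_pi_of_dependsOn μ (s := s j) (t := ⋃ i ∈ J₁, s i)
        (hdep j (Finset.mem_insert_self _ _)) ?_ ?_
      · intro x y hxy
        refine Finset.sum_congr rfl fun i hi => ?_
        exact hdep i (Finset.mem_insert_of_mem hi) fun e he =>
          hxy e (Set.mem_biUnion (Finset.mem_coe.2 hi) he)
      · rw [Set.disjoint_iUnion₂_right]
        intro i hi
        exact hs (by simp) (by simp [hi]) (by rintro rfl; exact hj hi)
    have h2 : (fun ω => ∑ i ∈ insert j J₁, (E i).indicator (fun _ => (1 : ℝ)) ω) =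
        (E j).indicator (fun _ => (1 : ℝ)) +
          (fun ω => ∑ i ∈ J₁, (E i).indicator (fun _ => (1 : ℝ)) ω) := by
      funext ω
      simp [Finset.sum_insert hj]
    have hm : mgf ((E j).indicator (fun _ => (1 : ℝ))) (Measure.pi μ) t ≤
        Real.exp ((Real.exp t - 1) * (Measure.pi μ).real (E j)) := by
      -- An indicator takes only the values `0` and `1`, so its moment generating function is `1 +
      -- (exp t - 1) P(E j)`, and `1 + x ≤ exp x` applies.
      have h3 : (fun ω => Real.exp (t * (E j).indicator (fun _ => (1 : ℝ)) ω)) =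
          fun ω => 1 + (E j).indicator (fun _ => Real.exp t - 1) ω := by
        funext ω
        by_cases hω : ω ∈ E j <;> simp [hω]
      rw [mgf, h3, integral_add (integrable_const _)
        ((integrable_const _).indicator (Set.toFinite _).measurableSet),
        integral_indicator_const _ (Set.toFinite _).measurableSet]
      simp only [integral_const, probReal_univ, smul_eq_mul, mul_one]
      rw [mul_comm, add_comm]
      exact Real.add_one_le_exp _
    rw [h2, h1.mgf_add (measurable_of_finite _).aestronglyMeasurable
      (measurable_of_finite _).aestronglyMeasurable, Finset.sum_insert hj, mul_add, Real.exp_add]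
    refine mul_le_mul hm (ih (fun i hi => hE i (Finset.mem_insert_of_mem hi))
      (hs.subset (by simp)) fun i hi => hdep i (Finset.mem_insert_of_mem hi)) mgf_nonneg
      (Real.exp_pos _).le

/-! ### The exploration of a graph -/

theorem expansion_zero {V : Type*} (G : SimpleGraph V) (U : Set V) : expansion G U 0 = U := by
  ext y
  simp [expansion]

theorem expansion_mono {V : Type*} (G : SimpleGraph V) (U : Set V) {k l : ℕ} (h : k ≤ l) :
    expansion G U k ⊆ expansion G U l := fun _ ⟨x, hx, hxy⟩ =>
  ⟨x, hx, hxy.trans (by exact_mod_cast h)⟩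

theorem mem_expansion_succ {V : Type*} (G : SimpleGraph V) (U : Set V) (k : ℕ) (y : V) :
    y ∈ expansion G U (k + 1) ↔
      y ∈ expansion G U k ∨ ∃ x ∈ expansion G U k, G.Adj x y := by
  constructor
  · rintro ⟨u, hu, huy⟩
    -- A walk realizing the distance; if it has full length `k + 1`, its penultimate vertex lies in
    -- `B_k`.
    obtain ⟨w, hw⟩ := SimpleGraph.exists_walk_of_edist_ne_top
      (ne_top_of_le_ne_top (ENat.natCast_ne_top (k + 1)) huy)
    rw [← hw] at huy
    have hlen : w.length ≤ k + 1 := by exact_mod_cast huy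
    rcases Nat.lt_or_ge k w.length with h | h
    · right
      refine ⟨w.penultimate, ⟨u, hu, ?_⟩, w.adj_penultimate ?_⟩
      · refine (SimpleGraph.edist_le w.dropLast).trans ?_
        have : w.dropLast.length ≤ k := by
          simp
          omega
        exact_mod_cast this
      · rw [← SimpleGraph.Walk.length_eq_zero_iff]
        omega
    · left
      exact ⟨u, hu, (SimpleGraph.edist_le w).trans (by exact_mod_cast h)⟩
  · rintro (h | ⟨x, ⟨u, hu, hux⟩, hxy⟩)
    · exact expansion_mono G U k.le_succ h
    · refine ⟨u, hu, (SimpleGraph.edist_triangle (v := x)).trans ?_⟩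
      rw [SimpleGraph.edist_eq_one_iff_adj.2 hxy]
      push_cast
      gcongr

theorem expansionBoundary_subset {V : Type*} (G : SimpleGraph V) (U : Set V) (k : ℕ) :
    expansionBoundary G U k ⊆ expansion G U k := by
  cases k with
  | zero => exact subset_rfl
  | succ k => exact Set.sdiff_subset

theorem expansion_succ_eq {V : Type*} (G : SimpleGraph V) (U : Set V) (k : ℕ) :
    expansion G U (k + 1) = expansion G U k ∪ expansionBoundary G U (k + 1) := by
  rw [expansionBoundary, Set.union_sdiff_cancel (expansion_mono G U k.le_succ)]

/-- Only the last layer can produce new sites, because the neighbours of `B_{k-1}` already lie in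
`B_k`. This identifies the next layer with `newSites`. -/
theorem expansionBoundary_succ_eq {V : Type*} (G : SimpleGraph V) (U : Set V) (k : ℕ) :
    expansionBoundary G U (k + 1) =
      {y | y ∉ expansion G U k ∧ ∃ x ∈ expansionBoundary G U k, G.Adj x y} := by
  ext y
  rw [expansionBoundary, Set.mem_sdiff, mem_expansion_succ, Set.mem_ofPred_eq]
  constructor
  · rintro ⟨h | ⟨x, hx, hxy⟩, hy⟩
    · exact (hy h).elim
    · refine ⟨hy, x, ?_, hxy⟩
      cases k with
      | zero => exact hx
      | succ k =>
        exact ⟨hx, fun h => hy ((mem_expansion_succ G U k y).2 (Or.inr ⟨x, h, hxy⟩))⟩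
  · rintro ⟨hy, x, hx, hxy⟩
    exact ⟨Or.inr ⟨x, expansionBoundary_subset G U k hx, hxy⟩, hy⟩

/-- Changing edges between `∂B_k` and the complement of `B_k` does not affect `B_j` for `j ≤ k`. -/
theorem expansion_congr {V : Type*} (G G' : SimpleGraph V) (U : Set V) (k : ℕ)
    (h : ∀ x y, ¬ (x ∈ expansionBoundary G U k ∧ y ∉ expansion G U k) →
      ¬ (y ∈ expansionBoundary G U k ∧ x ∉ expansion G U k) → (G.Adj x y ↔ G'.Adj x y)) :
    ∀ j ≤ k, expansion G U j = expansion G' U j := by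
  intro j
  induction j with
  | zero => intro _; simp only [expansion_zero]
  | succ j ih =>
    intro hj
    have ih := ih (by omega)
    ext y
    rw [mem_expansion_succ, mem_expansion_succ, ← ih]
    refine or_congr Iff.rfl (exists_congr fun x => and_congr_right fun hx => ?_)
    -- Since `j < k`, the site `x` lies in `B_{k-1}`: it is neither in `∂B_k` nor outside `B_k`, so
    -- its pairs are among the unchanged ones.
    obtain ⟨k, rfl⟩ : ∃ k', k = k' + 1 := ⟨k - 1, by omega⟩
    have hxk : x ∈ expansion G U k := expansion_mono G U (by omega) hx
    refine h x y (fun hh => hh.1.2 hxk) fun hh => hh.2 (expansion_mono G U k.le_succ hxk)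

theorem expansionBoundary_eq_of_forall {V : Type*} (G G' : SimpleGraph V) (U : Set V) (k : ℕ)
    (h : ∀ j ≤ k, expansion G U j = expansion G' U j) :
    expansionBoundary G U k = expansionBoundary G' U k := by
  cases k with
  | zero => exact h 0 le_rfl
  | succ k => rw [expansionBoundary, expansionBoundary, h _ le_rfl, h k k.le_succ]

/-! ### Sums over the box -/

theorem card_natAbs_sub_eq_le {N : ℕ} (a : Fin (N + 1)) (r : ℕ) :
    (Finset.univ.filter fun b : Fin (N + 1) =>
      (((a : ℕ) : ℤ) - ((b : ℕ) : ℤ)).natAbs = r).card ≤ 2 := by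
  refine (Finset.card_le_card_of_injOn (t := {((a : ℕ) : ℤ) - r, ((a : ℕ) : ℤ) + r})
    (fun b : Fin (N + 1) => ((b : ℕ) : ℤ)) ?_ ?_).trans Finset.card_le_two
  · intro b hb
    simp only [Finset.coe_filter, Finset.mem_univ, true_and, Set.mem_ofPred_eq] at hb
    simp only [Finset.coe_insert, Finset.coe_singleton, Set.mem_insert_iff, Set.mem_singleton_iff]
    omega
  · intro b _ c _ h
    exact Fin.ext (by simpa using h)

theorem card_natAbs_sub_le_le {N : ℕ} (a : Fin (N + 1)) (r : ℕ) :
    (Finset.univ.filter fun b : Fin (N + 1) =>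
      (((a : ℕ) : ℤ) - ((b : ℕ) : ℤ)).natAbs ≤ r).card ≤ 2 * r + 1 := by
  refine (Finset.card_le_card_of_injOn (t := Finset.Icc (((a : ℕ) : ℤ) - r) (((a : ℕ) : ℤ) + r))
    (fun b : Fin (N + 1) => ((b : ℕ) : ℤ)) ?_ ?_).trans ?_
  · intro b hb
    simp only [Finset.coe_filter, Finset.mem_univ, true_and, Set.mem_ofPred_eq] at hb
    simp only [Finset.coe_Icc, Set.mem_Icc]
    omega
  · intro b _ c _ h
    exact Fin.ext (by simpa using h)
  · rw [Int.card_Icc]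
    omega

theorem one_le_card_natAbs_sub_eq {N : ℕ} (a : Fin (N + 1)) (r : ℕ) (hr : r ≤ N / 2) :
    1 ≤ (Finset.univ.filter fun b : Fin (N + 1) =>
      (((a : ℕ) : ℤ) - ((b : ℕ) : ℤ)).natAbs = r).card := by
  rw [Nat.one_le_iff_ne_zero, ← Nat.pos_iff_ne_zero, Finset.card_pos]
  rcases le_or_gt ((a : ℕ) + r) N with h | h
  · exact ⟨⟨a + r, by omega⟩, by simp⟩
  · refine ⟨⟨a - r, by omega⟩, ?_⟩
    simp only [Finset.mem_filter, Finset.mem_univ, true_and]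
    omega

/-- As `r ≤ N / 2`, at least one of the two sides of `a` has room for `r` points inside the box. -/
theorem le_card_natAbs_sub_le {N : ℕ} (a : Fin (N + 1)) (r : ℕ) (hr : r ≤ N / 2) :
    r ≤ (Finset.univ.filter fun b : Fin (N + 1) =>
      (((a : ℕ) : ℤ) - ((b : ℕ) : ℤ)).natAbs ≤ r).card := by
  rcases le_or_gt ((a : ℕ) + r) N with h | h
  · have := Finset.card_le_card_of_injOn (s := Finset.univ) (t := Finset.univ.filter
      fun b : Fin (N + 1) => (((a : ℕ) : ℤ) - ((b : ℕ) : ℤ)).natAbs ≤ r)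
      (fun t : Fin r => (⟨a + t, by omega⟩ : Fin (N + 1)))
      (by
        intro t _
        simp only [Finset.coe_filter, Finset.mem_univ, true_and, Set.mem_ofPred_eq]
        omega)
      (by
        intro t _ u _ htu
        simp only [Fin.mk.injEq] at htu
        exact Fin.ext (by omega))
    simpa using this
  · have := Finset.card_le_card_of_injOn (s := Finset.univ) (t := Finset.univ.filter
      fun b : Fin (N + 1) => (((a : ℕ) : ℤ) - ((b : ℕ) : ℤ)).natAbs ≤ r)
      (fun t : Fin r => (⟨a - t, by omega⟩ : Fin (N + 1)))
      (by
        intro t _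
        simp only [Finset.coe_filter, Finset.mem_univ, true_and, Set.mem_ofPred_eq]
        omega)
      (by
        intro t _ u _ htu
        simp only [Fin.mk.injEq] at htu
        exact Fin.ext (by omega))
    simpa using this

/-- The face `{y | |x i - y i| = r, |x j - y j| ≤ r for all j}` of a sup-norm sphere. -/
def sphereFace {d N : ℕ} (x : Site d N) (i : Fin d) (r : ℕ) : Finset (Site d N) :=
  Fintype.piFinset fun j =>
    if j = i then Finset.univ.filter fun b : Fin (N + 1) =>
      (((x j : ℕ) : ℤ) - ((b : ℕ) : ℤ)).natAbs = r
    else Finset.univ.filter fun b : Fin (N + 1) => (((x j : ℕ) : ℤ) - ((b : ℕ) : ℤ)).natAbs ≤ r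

theorem mem_sphereFace {d N : ℕ} {x : Site d N} {i : Fin d} {r : ℕ} {y : Site d N} :
    y ∈ sphereFace x i r ↔ (((x i : ℕ) : ℤ) - ((y i : ℕ) : ℤ)).natAbs = r ∧
      ∀ j, (((x j : ℕ) : ℤ) - ((y j : ℕ) : ℤ)).natAbs ≤ r := by
  rw [sphereFace, Fintype.mem_piFinset]
  constructor
  · intro h
    have hi := h i
    simp only [if_true, Finset.mem_filter, Finset.mem_univ, true_and] at hi
    refine ⟨hi, fun j => ?_⟩
    by_cases hj : j = i
    · subst hj; exact hi.le
    · simpa [hj] using h j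
  · rintro ⟨hi, h⟩ j
    by_cases hj : j = i
    · subst hj; simpa using hi
    · simpa [hj] using h j

theorem card_sphereFace_le {d N : ℕ} (x : Site d N) (i : Fin d) (r : ℕ) :
    (sphereFace x i r).card ≤ 2 * (2 * r + 1) ^ (d - 1) := by
  rw [sphereFace, Fintype.card_piFinset, ← Finset.mul_prod_erase _ _ (Finset.mem_univ i)]
  refine Nat.mul_le_mul ?_ ?_
  · simpa using card_natAbs_sub_eq_le (x i) r
  · refine (Finset.prod_le_pow_card _ _ (2 * r + 1) fun j hj => ?_).trans (by simp)
    simpa [Finset.ne_of_mem_erase hj] using card_natAbs_sub_le_le (x j) r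

theorem le_card_sphereFace {d N : ℕ} (x : Site d N) (i : Fin d) (r : ℕ) (hr : r ≤ N / 2) :
    r ^ (d - 1) ≤ (sphereFace x i r).card := by
  rw [sphereFace, Fintype.card_piFinset, ← Finset.mul_prod_erase _ _ (Finset.mem_univ i)]
  have h1 : r ^ (d - 1) = 1 * ∏ _j ∈ (Finset.univ : Finset (Fin d)).erase i, r := by simp
  rw [h1]
  refine Nat.mul_le_mul ?_ (Finset.prod_le_prod' fun j hj => ?_)
  · simpa using one_le_card_natAbs_sub_eq (x i) r hr
  · simpa [Finset.ne_of_mem_erase hj] using le_card_natAbs_sub_le (x j) r hr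

theorem natAbs_sub_le_l1Dist {d N : ℕ} (x y : Site d N) (i : Fin d) :
    (((x i : ℕ) : ℤ) - ((y i : ℕ) : ℤ)).natAbs ≤ l1Dist x y :=
  Finset.single_le_sum (f := fun i => (((x i : ℕ) : ℤ) - ((y i : ℕ) : ℤ)).natAbs)
    (fun _ _ => Nat.zero_le _) (Finset.mem_univ i)

theorem l1Dist_le_of_mem_sphereFace {d N : ℕ} {x y : Site d N} {i : Fin d} {r : ℕ}
    (h : y ∈ sphereFace x i r) : l1Dist x y ≤ d * r := by
  refine (Finset.sum_le_card_nsmul _ _ r fun j _ => (mem_sphereFace.1 h).2 j).trans ?_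
  simp

theorem l1Dist_pos {d N : ℕ} {x y : Site d N} (h : y ≠ x) : 0 < l1Dist x y := by
  obtain ⟨i, hi⟩ := Function.ne_iff.1 h
  have h1 := natAbs_sub_le_l1Dist x y i
  have h2 : ((y i : ℕ)) ≠ (x i : ℕ) := fun h => hi (Fin.ext h)
  omega

/-- The coordinate with the largest difference gives the face, and that difference is the radius.
The faces thus cover all `y ≠ x`, possibly with repetitions, which is enough for an upper bound. -/
theorem exists_mem_sphereFace {d N : ℕ} {x y : Site d N} (h : y ≠ x) :
    ∃ i, ∃ r ∈ Finset.Icc 1 N, y ∈ sphereFace x i r ∧ r ≤ l1Dist x y := by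
  obtain ⟨i₀, hi₀⟩ := Function.ne_iff.1 h
  have : Nonempty (Fin d) := ⟨i₀⟩
  obtain ⟨i, hi⟩ := Finite.exists_max fun i => (((x i : ℕ) : ℤ) - ((y i : ℕ) : ℤ)).natAbs
  refine ⟨i, (((x i : ℕ) : ℤ) - ((y i : ℕ) : ℤ)).natAbs, ?_, mem_sphereFace.2 ⟨rfl, hi⟩,
    natAbs_sub_le_l1Dist x y i⟩
  have h1 := hi i₀
  have h2 : ((y i₀ : ℕ)) ≠ (x i₀ : ℕ) := fun h => hi₀ (Fin.ext h)
  rw [Finset.mem_Icc]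
  have := (x i).2
  have := (y i).2
  omega

theorem sum_one_div_le_one_add_log (N : ℕ) :
    ∑ r ∈ Finset.Icc 1 N, (1 : ℝ) / r ≤ 1 + Real.log N := by
  have h := harmonic_le_one_add_log N
  rw [harmonic_eq_sum_Icc] at h
  push_cast at h
  simpa using h

/-- Telescoping of `log (1 + 1 / r) ≤ 1 / r`; for `M < R` the sum is empty and the logarithm is
nonpositive. -/
theorem log_div_le_sum_one_div {R : ℕ} (hR : 1 ≤ R) (M : ℕ) :
    Real.log ((M + 1 : ℝ) / R) ≤ ∑ r ∈ Finset.Icc R M, (1 : ℝ) / r := by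
  have hR' : (1 : ℝ) ≤ R := by exact_mod_cast hR
  have triv : ∀ M : ℕ, M + 1 ≤ R →
      Real.log ((M + 1 : ℝ) / R) ≤ ∑ r ∈ Finset.Icc R M, (1 : ℝ) / r := by
    intro M hM
    refine (Real.log_nonpos (by positivity) ?_).trans
      (Finset.sum_nonneg fun r _ => by positivity)
    rw [div_le_one (by linarith)]
    exact_mod_cast hM
  induction M with
  | zero => exact triv 0 (by omega)
  | succ M ih =>
    rcases Nat.lt_or_ge (M + 1) R with h | h
    · exact triv (M + 1) (by omega)
    · rw [Finset.sum_Icc_succ_top h]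
      have h1 : ((M + 1 : ℕ) + 1 : ℝ) / R = (M + 1 : ℝ) / R * (1 + 1 / ((M + 1 : ℕ) : ℝ)) := by
        push_cast
        field_simp
      rw [h1, Real.log_mul (by positivity) (by positivity)]
      have h2 := Real.log_le_sub_one_of_pos (x := 1 + 1 / ((M + 1 : ℕ) : ℝ)) (by positivity)
      linarith

theorem sum_one_div_l1Dist_le {d N : ℕ} (x : Site d N) :
    ∑ y ∈ Finset.univ.erase x, (1 : ℝ) / (l1Dist x y : ℝ) ^ d ≤
      2 * d * 3 ^ d * (1 + Real.log N) := by
  classical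
  calc ∑ y ∈ Finset.univ.erase x, (1 : ℝ) / (l1Dist x y : ℝ) ^ d
      ≤ ∑ y ∈ Finset.univ.erase x, ∑ i : Fin d, ∑ r ∈ Finset.Icc 1 N,
          if y ∈ sphereFace x i r then (1 : ℝ) / (r : ℝ) ^ d else 0 := by
        refine Finset.sum_le_sum fun y hy => ?_
        obtain ⟨i, r, hr, hm, hle⟩ := exists_mem_sphereFace (Finset.ne_of_mem_erase hy)
        have hr1 : (1 : ℝ) ≤ r := by exact_mod_cast (Finset.mem_Icc.1 hr).1
        refine le_trans ?_ (Finset.single_le_sum (f := fun i => ∑ r ∈ Finset.Icc 1 N,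
          if y ∈ sphereFace x i r then (1 : ℝ) / (r : ℝ) ^ d else 0)
          (fun i _ => Finset.sum_nonneg fun r _ => by split_ifs <;> positivity)
          (Finset.mem_univ i))
        refine le_trans ?_ (Finset.single_le_sum (f := fun r =>
          if y ∈ sphereFace x i r then (1 : ℝ) / (r : ℝ) ^ d else 0)
          (fun r _ => by split_ifs <;> positivity) hr)
        rw [if_pos hm]
        have : (r : ℝ) ≤ l1Dist x y := by exact_mod_cast hle
        gcongr
    _ = ∑ i : Fin d, ∑ r ∈ Finset.Icc 1 N, ∑ y ∈ Finset.univ.erase x,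
          if y ∈ sphereFace x i r then (1 : ℝ) / (r : ℝ) ^ d else 0 := by
        rw [Finset.sum_comm]
        exact Finset.sum_congr rfl fun i _ => Finset.sum_comm
    _ ≤ ∑ i : Fin d, ∑ r ∈ Finset.Icc 1 N, 2 * 3 ^ d * ((1 : ℝ) / r) := by
        refine Finset.sum_le_sum fun i _ => Finset.sum_le_sum fun r hr => ?_
        have hr1 : (1 : ℝ) ≤ r := by exact_mod_cast (Finset.mem_Icc.1 hr).1
        obtain ⟨e, rfl⟩ : ∃ e, d = e + 1 := ⟨d - 1, by have := i.2; omega⟩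
        calc ∑ y ∈ Finset.univ.erase x,
              (if y ∈ sphereFace x i r then (1 : ℝ) / (r : ℝ) ^ (e + 1) else 0)
            ≤ ∑ y, (if y ∈ sphereFace x i r then (1 : ℝ) / (r : ℝ) ^ (e + 1) else 0) :=
              Finset.sum_le_sum_of_subset_of_nonneg (Finset.subset_univ _)
                fun y _ _ => by split_ifs <;> positivity
          _ = (sphereFace x i r).card * ((1 : ℝ) / (r : ℝ) ^ (e + 1)) := by
              rw [← Finset.sum_filter]
              simp
          _ ≤ (2 * (3 * r) ^ e) * ((1 : ℝ) / (r : ℝ) ^ (e + 1)) := by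
              have h1 : ((sphereFace x i r).card : ℝ) ≤ 2 * (2 * r + 1) ^ e := by
                exact_mod_cast card_sphereFace_le x i r
              have h2 : (2 * r + 1 : ℝ) ^ e ≤ (3 * r) ^ e := by
                gcongr
                linarith
              gcongr
              linarith
          _ = 2 * 3 ^ e * (1 / r) := by
              rw [mul_pow, pow_succ]
              field_simp
          _ ≤ 2 * 3 ^ (e + 1) * (1 / r) := by
              gcongr
              · norm_num
              · omega
    _ = d * (2 * 3 ^ d) * ∑ r ∈ Finset.Icc 1 N, (1 : ℝ) / r := by
        simp [← Finset.mul_sum, mul_assoc]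
    _ ≤ d * (2 * 3 ^ d) * (1 + Real.log N) := by
        gcongr
        exact sum_one_div_le_one_add_log N
    _ = _ := by ring

/-- The faces in one fixed direction suffice. They are disjoint for different radii `r`, and each
has at least `r ^ (d - 1)` sites at distance at most `d r`, so it contributes at least `d ^ (-d) /
r`. -/
theorem le_sum_one_div_l1Dist {d N R : ℕ} (hd : 1 ≤ d) (hN : 1 ≤ N) (hR : 1 ≤ R) (x : Site d N) :
    1 / (d : ℝ) ^ d * Real.log (N / (2 * R)) ≤
      ∑ y ∈ Finset.univ.filter (fun y => R ≤ l1Dist x y), (1 : ℝ) / (l1Dist x y : ℝ) ^ d := by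
  classical
  obtain ⟨e, rfl⟩ : ∃ e, d = e + 1 := ⟨d - 1, by omega⟩
  have hR' : (1 : ℝ) ≤ R := by exact_mod_cast hR
  have hdisj : ((Finset.Icc R (N / 2) : Finset ℕ) : Set ℕ).PairwiseDisjoint (sphereFace x 0) := by
    intro r _ s _ hrs
    refine Finset.disjoint_left.2 fun y hy hy' => hrs ?_
    rw [← (mem_sphereFace.1 hy).1, ← (mem_sphereFace.1 hy').1]
  have hlog : Real.log (N / (2 * R)) ≤ Real.log (((N / 2 : ℕ) + 1 : ℝ) / R) := by
    have hN' : (1 : ℝ) ≤ N := by exact_mod_cast hN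
    refine Real.log_le_log (by positivity) ?_
    rw [div_le_div_iff₀ (by positivity) (by positivity)]
    have : (N : ℝ) ≤ 2 * ((N / 2 : ℕ) + 1) := by
      have : N ≤ 2 * (N / 2 + 1) := by omega
      exact_mod_cast this
    nlinarith
  calc 1 / ((e + 1 : ℕ) : ℝ) ^ (e + 1) * Real.log (N / (2 * R))
      ≤ 1 / ((e + 1 : ℕ) : ℝ) ^ (e + 1) * ∑ r ∈ Finset.Icc R (N / 2), (1 : ℝ) / r := by
        gcongr
        exact hlog.trans (log_div_le_sum_one_div hR _)
    _ = ∑ r ∈ Finset.Icc R (N / 2), 1 / ((e + 1 : ℕ) : ℝ) ^ (e + 1) * ((1 : ℝ) / r) :=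
        Finset.mul_sum _ _ _
    _ ≤ ∑ r ∈ Finset.Icc R (N / 2), ∑ y ∈ sphereFace x 0 r,
          (1 : ℝ) / (l1Dist x y : ℝ) ^ (e + 1) := by
        refine Finset.sum_le_sum fun r hr => ?_
        rw [Finset.mem_Icc] at hr
        have hr1 : (1 : ℝ) ≤ r := hR'.trans (by exact_mod_cast hr.1)
        calc 1 / ((e + 1 : ℕ) : ℝ) ^ (e + 1) * ((1 : ℝ) / r)
            = (r : ℝ) ^ e * (1 / (((e + 1 : ℕ) : ℝ) * r) ^ (e + 1)) := by
              rw [mul_pow, pow_succ (r : ℝ)]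
              field_simp
          _ ≤ ((sphereFace x 0 r).card : ℝ) * (1 / (((e + 1 : ℕ) : ℝ) * r) ^ (e + 1)) := by
              have : (r : ℝ) ^ e ≤ (sphereFace x 0 r).card := by
                exact_mod_cast le_card_sphereFace x 0 r hr.2
              gcongr
          _ = ∑ y ∈ sphereFace x 0 r, (1 / (((e + 1 : ℕ) : ℝ) * r) ^ (e + 1)) := by simp
          _ ≤ _ := by
              refine Finset.sum_le_sum fun y hy => ?_
              have h1 : (l1Dist x y : ℝ) ≤ ((e + 1 : ℕ) : ℝ) * r := by
                exact_mod_cast l1Dist_le_of_mem_sphereFace hy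
              have h2 : (r : ℝ) ≤ l1Dist x y := by
                have := natAbs_sub_le_l1Dist x y 0
                rw [(mem_sphereFace.1 hy).1] at this
                exact_mod_cast this
              have h3 : (0 : ℝ) < l1Dist x y := by linarith
              gcongr
    _ = ∑ y ∈ (Finset.Icc R (N / 2)).biUnion (sphereFace x 0),
          (1 : ℝ) / (l1Dist x y : ℝ) ^ (e + 1) := (Finset.sum_biUnion hdisj).symm
    _ ≤ _ := by
        refine Finset.sum_le_sum_of_subset_of_nonneg ?_ fun y _ _ => by positivity
        intro y hy
        obtain ⟨r, hr, hy⟩ := Finset.mem_biUnion.1 hy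
        rw [Finset.mem_filter]
        refine ⟨Finset.mem_univ y, ?_⟩
        have := natAbs_sub_le_l1Dist x y 0
        rw [(mem_sphereFace.1 hy).1] at this
        exact (Finset.mem_Icc.1 hr).1.trans this

/-! ### Connection probabilities -/

/-- The summand `1` in `1 + β` pays for the nearest neighbours, the summand `β` for all other pairs.
-/
theorem connProb_le {d N : ℕ} {β : ℝ} (hβ : 0 ≤ β) {x y : Site d N} (h : y ≠ x) :
    connProb β s(x, y) ≤ (1 + β) * (1 / (l1Dist x y : ℝ) ^ d) := by
  have h1 : (1 : ℝ) ≤ l1Dist x y := by exact_mod_cast l1Dist_pos h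
  simp only [connProb, Sym2.lift_mk]
  split_ifs with h2
  · rw [h2]
    simpa using hβ
  · have h3 := Real.add_one_le_exp (-(β / (l1Dist x y : ℝ) ^ d))
    have h4 : (1 + β) * (1 / (l1Dist x y : ℝ) ^ d) =
        1 / (l1Dist x y : ℝ) ^ d + β / (l1Dist x y : ℝ) ^ d := by ring
    have h5 : (0 : ℝ) ≤ 1 / (l1Dist x y : ℝ) ^ d := by positivity
    linarith

theorem connProb_le_of_le {d N R : ℕ} {β : ℝ} (hβ : 0 ≤ β) (hR : 2 ≤ R) {x y : Site d N}
    (h : R ≤ l1Dist x y) : connProb β s(x, y) ≤ β / (R : ℝ) ^ d := by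
  have h1 : (R : ℝ) ≤ l1Dist x y := by exact_mod_cast h
  have hR' : (2 : ℝ) ≤ R := by exact_mod_cast hR
  simp only [connProb, Sym2.lift_mk]
  rw [if_neg (by omega)]
  have h3 := Real.add_one_le_exp (-(β / (l1Dist x y : ℝ) ^ d))
  have h4 : β / (l1Dist x y : ℝ) ^ d ≤ β / (R : ℝ) ^ d := by gcongr
  linarith

theorem exp_neg_le_one_sub_half {v : ℝ} (h0 : 0 ≤ v) (h1 : v ≤ 1) :
    Real.exp (-v) ≤ 1 - v / 2 := by
  have h2 : Real.exp (-v) ≤ 1 / (1 + v) := by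
    rw [Real.exp_neg, ← one_div]
    exact one_div_le_one_div_of_le (by linarith) (by linarith [Real.add_one_le_exp v])
  refine h2.trans ?_
  rw [div_le_iff₀ (by linarith)]
  nlinarith

theorem le_connProb {d N R : ℕ} {β : ℝ} (hβ : 0 ≤ β) (hR : 1 ≤ R) (hRβ : β ≤ (R : ℝ) ^ d)
    {x y : Site d N} (h : R ≤ l1Dist x y) :
    β / 2 * (1 / (l1Dist x y : ℝ) ^ d) ≤ connProb β s(x, y) := by
  have h1 : (R : ℝ) ≤ l1Dist x y := by exact_mod_cast h
  have hR' : (1 : ℝ) ≤ R := by exact_mod_cast hR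
  have h4 : β / (l1Dist x y : ℝ) ^ d ≤ 1 := by
    rw [div_le_one]
    · exact hRβ.trans (by gcongr)
    · have : (0 : ℝ) < l1Dist x y := by linarith
      positivity
  have h5 : 0 ≤ β / (l1Dist x y : ℝ) ^ d := by positivity
  have h6 : β / 2 * (1 / (l1Dist x y : ℝ) ^ d) = β / (l1Dist x y : ℝ) ^ d / 2 := by ring
  rw [h6]
  simp only [connProb, Sym2.lift_mk]
  split_ifs
  · linarith
  · linarith [exp_neg_le_one_sub_half h5 h4]

theorem lrpLaw_real_open {d N : ℕ} {β : ℝ} (hβ : 0 ≤ β) (e : SitePair d N) :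
    (lrpLaw d N β).real {ω | ω e = true} = connProb β e.1 := by
  have h : {ω : Config d N | ω e = true} = Function.eval e ⁻¹' ({true} : Set Bool) := rfl
  rw [h, lrpLaw, measureReal_def,
    (measurePreserving_eval _ e).measure_preimage (MeasurableSet.singleton _).nullMeasurableSet,
    ← measureReal_def, bernoulliMeasure_real_apply_of_mem_of_notMem _ (MeasurableSet.singleton _)
      (by simp) (by simp), Set.projIcc_of_mem zero_le_one (connProb_mem hβ e.1)]

theorem lrpGraph_adj {d N : ℕ} {ω : Config d N} {x y : Site d N} :
    (lrpGraph ω).Adj x y ↔ ∃ h : ¬ s(x, y).IsDiag, ω ⟨s(x, y), h⟩ = true := by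
  rw [lrpGraph, SimpleGraph.fromEdgeSet_adj]
  constructor
  · exact fun h => h.1
  · rintro ⟨h, h'⟩
    exact ⟨⟨h, h'⟩, fun hxy => h (by simpa using hxy)⟩

/-- The event that the site `y` is adjacent to a site of `S`. -/
def adjEvent {d N : ℕ} (S : Finset (Site d N)) (y : Site d N) : Set (Config d N) :=
  {ω | ∃ x ∈ S, (lrpGraph ω).Adj x y}

/-- The potential edges between `S` and `y`. -/
def pairsTo {d N : ℕ} (S : Finset (Site d N)) (y : Site d N) : Set (SitePair d N) :=
  {e | ∃ x ∈ S, e.1 = s(x, y)}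

theorem dependsOn_adjEvent {d N : ℕ} (S : Finset (Site d N)) (y : Site d N) :
    DependsOn (· ∈ adjEvent S y) (pairsTo S y) := by
  intro ω ω' h
  refine propext (exists_congr fun x => and_congr_right fun hx => ?_)
  rw [lrpGraph_adj, lrpGraph_adj]
  refine exists_congr fun hd => ?_
  rw [h ⟨s(x, y), hd⟩ ⟨x, hx, rfl⟩]

/-- A pair shared by `y` and `y' ≠ y` would have to be `{y, y'}`, with `y' ∈ S ⊆ A`. -/
theorem pairwiseDisjoint_pairsTo {d N : ℕ} {S A : Finset (Site d N)} (hSA : S ⊆ A) :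
    ((Aᶜ : Finset (Site d N)) : Set (Site d N)).PairwiseDisjoint (pairsTo S) := by
  intro y hy y' hy' hne
  refine Set.disjoint_left.2 ?_
  rintro e ⟨x, hx, he⟩ ⟨x', hx', he'⟩
  rw [he, Sym2.eq_iff] at he'
  rcases he' with ⟨_, h⟩ | ⟨h, _⟩
  · exact hne h
  · subst h
    exact (Finset.mem_compl.1 (Finset.mem_coe.1 hy')) (hSA hx)

theorem lrpLaw_adj {d N : ℕ} {β : ℝ} (hβ : 0 ≤ β) {x y : Site d N} (hxy : x ≠ y) :
    (lrpLaw d N β).real {ω | (lrpGraph ω).Adj x y} = connProb β s(x, y) := by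
  have hd : ¬ s(x, y).IsDiag := by simpa using hxy
  rw [← lrpLaw_real_open hβ ⟨s(x, y), hd⟩]
  congr 1
  ext ω
  simp [lrpGraph_adj, hd]

theorem lrpLaw_adjEvent_le {d N : ℕ} {β : ℝ} (hβ : 0 ≤ β) {S : Finset (Site d N)}
    {y : Site d N} (hy : y ∉ S) :
    (lrpLaw d N β).real (adjEvent S y) ≤ ∑ x ∈ S, connProb β s(x, y) := by
  have h : adjEvent S y = ⋃ x ∈ S, {ω : Config d N | (lrpGraph ω).Adj x y} := by
    ext ω
    simp [adjEvent]
  rw [h]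
  refine (measureReal_biUnion_finset_le _ _).trans (Finset.sum_le_sum fun x hx => ?_)
  rw [lrpLaw_adj hβ (by rintro rfl; exact hy hx)]

theorem exp_one_sub_one_le_two : Real.exp 1 - 1 ≤ 2 := by
  linarith [Real.exp_one_lt_d9]

theorem exp_neg_one_sub_one_le : Real.exp (-1) - 1 ≤ -(1 / 2) := by
  have := exp_neg_le_one_sub_half zero_le_one le_rfl
  linarith

/-- Let `Z` be the number of open pairs between `S` and `y`, with mean `u`. Chernoff's bound gives
`P(Z = 0) ≤ exp (-u / 2)`, which is at most `1 - u / 4` because `u ≤ 1`. -/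
theorem le_lrpLaw_adjEvent {d N : ℕ} {β : ℝ} (hβ : 0 ≤ β) {S : Finset (Site d N)}
    {y : Site d N} (hy : y ∉ S) (h1 : ∑ x ∈ S, connProb β s(x, y) ≤ 1) :
    1 / 4 * ∑ x ∈ S, connProb β s(x, y) ≤ (lrpLaw d N β).real (adjEvent S y) := by
  classical
  set u := ∑ x ∈ S, connProb β s(x, y) with hu
  have hu0 : 0 ≤ u := Finset.sum_nonneg fun x _ => (connProb_mem hβ _).1
  set Z : Config d N → ℝ := fun ω => ∑ x ∈ S, {ω : Config d N | (lrpGraph ω).Adj x y}.indicator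
    (fun _ => (1 : ℝ)) ω with hZ
  have hmgf : mgf Z (lrpLaw d N β) (-1) ≤ Real.exp ((Real.exp (-1) - 1) * u) := by
    have h2 : u = ∑ x ∈ S, (lrpLaw d N β).real {ω | (lrpGraph ω).Adj x y} :=
      Finset.sum_congr rfl fun x hx => (lrpLaw_adj hβ (by rintro rfl; exact hy hx)).symm
    rw [h2]
    refine mgf_sum_indicator_le _ (fun x => {ω : Config d N | (lrpGraph ω).Adj x y})
      (fun x => {e : SitePair d N | e.1 = s(x, y)}) S ?_ ?_ (-1)
    · intro x hx ω ω' h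
      simp only [Set.mem_ofPred_eq, lrpGraph_adj]
      refine propext (exists_congr fun hd => ?_)
      rw [h ⟨s(x, y), hd⟩ rfl]
    · intro x hx x' hx' hne
      refine Set.disjoint_left.2 fun e he he' => hne ?_
      simp only [Set.mem_ofPred_eq] at he he'
      rw [he, Sym2.eq_iff] at he'
      rcases he' with ⟨h, _⟩ | ⟨h, h'⟩
      · exact h
      · exact h.trans h'
  have hch := measure_le_le_exp_mul_mgf (μ := lrpLaw d N β) (X := Z) (t := -1) 0 (by norm_num)
    Integrable.of_finite
  have hcompl : {ω | Z ω ≤ 0} = (adjEvent S y)ᶜ := by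
    ext ω
    rw [Set.mem_ofPred_eq, Set.mem_compl_iff, adjEvent, Set.mem_ofPred_eq]
    have hnn : ∀ x ∈ S, 0 ≤ {ω : Config d N | (lrpGraph ω).Adj x y}.indicator
        (fun _ => (1 : ℝ)) ω := fun x _ =>
      Set.indicator_nonneg (fun _ _ => zero_le_one) _
    constructor
    · rintro h ⟨x, hx, hadj⟩
      have := (Finset.single_le_sum hnn hx).trans h
      rw [Set.indicator_of_mem (show ω ∈ {ω : Config d N | (lrpGraph ω).Adj x y} from hadj)] at this
      linarith
    · intro h
      have hZ0 : Z ω = 0 := Finset.sum_eq_zero fun x hx =>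
        Set.indicator_of_notMem (s := {ω : Config d N | (lrpGraph ω).Adj x y})
          (fun hadj => h ⟨x, hx, hadj⟩) _
      exact hZ0.le
  rw [hcompl, probReal_compl_eq_one_sub (Set.toFinite _).measurableSet] at hch
  have h3 : Real.exp ((Real.exp (-1) - 1) * u) ≤ Real.exp (-(u / 2)) :=
    Real.exp_le_exp.2 (by nlinarith [exp_neg_one_sub_one_le])
  have h4 := exp_neg_le_one_sub_half (v := u / 2) (by linarith) (by linarith)
  simp only [mul_zero, Real.exp_zero, one_mul] at hch
  linarith

theorem adjEvent_mono {d N : ℕ} {S S' : Finset (Site d N)} (h : S ⊆ S') (y : Site d N) :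
    adjEvent S y ⊆ adjEvent S' y := fun _ ⟨x, hx, hxy⟩ => ⟨x, h hx, hxy⟩

theorem sum_adjEvent_le {d N : ℕ} {β : ℝ} (hβ : 0 ≤ β) {S A : Finset (Site d N)} (hSA : S ⊆ A) :
    ∑ y ∈ Aᶜ, (lrpLaw d N β).real (adjEvent S y) ≤
      (1 + β) * (2 * d * 3 ^ d * (1 + Real.log N)) * S.card := by
  classical
  calc ∑ y ∈ Aᶜ, (lrpLaw d N β).real (adjEvent S y)
      ≤ ∑ y ∈ Aᶜ, ∑ x ∈ S, connProb β s(x, y) :=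
        Finset.sum_le_sum fun y hy => lrpLaw_adjEvent_le hβ
          fun h => Finset.mem_compl.1 hy (hSA h)
    _ = ∑ x ∈ S, ∑ y ∈ Aᶜ, connProb β s(x, y) := Finset.sum_comm
    _ ≤ ∑ x ∈ S, (1 + β) * (2 * d * 3 ^ d * (1 + Real.log N)) := by
        refine Finset.sum_le_sum fun x hx => ?_
        calc ∑ y ∈ Aᶜ, connProb β s(x, y)
            ≤ ∑ y ∈ Finset.univ.erase x, connProb β s(x, y) := by
              refine Finset.sum_le_sum_of_subset_of_nonneg ?_ fun y _ _ => (connProb_mem hβ _).1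
              intro y hy
              simp only [Finset.mem_erase, Finset.mem_univ, and_true]
              rintro rfl
              exact Finset.mem_compl.1 hy (hSA hx)
          _ ≤ ∑ y ∈ Finset.univ.erase x, (1 + β) * (1 / (l1Dist x y : ℝ) ^ d) :=
              Finset.sum_le_sum fun y hy => connProb_le hβ (Finset.ne_of_mem_erase hy)
          _ ≤ _ := by
              rw [← Finset.mul_sum]
              gcongr
              exact sum_one_div_l1Dist_le x
    _ = _ := by
        simp only [Finset.sum_const, nsmul_eq_mul]
        ring

/-- The hypothesis `hA` is used twice: long edges from `x ∈ S` into `A` account for at most `1`,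
which is the subtracted term, and long edges from `S` to a single `y` also sum to at most `1`, so
that `le_lrpLaw_adjEvent` applies. -/
theorem le_sum_adjEvent {d N R : ℕ} {β : ℝ} (hd : 1 ≤ d) (hN : 1 ≤ N) (hβ : 0 ≤ β) (hR : 2 ≤ R)
    {S A : Finset (Site d N)} (hSA : S ⊆ A) (hS : S.Nonempty)
    (hA : β * A.card ≤ (R : ℝ) ^ d) :
    1 / 4 * (β / 2 * (1 / (d : ℝ) ^ d * Real.log (N / (2 * R))) - 1) * S.card ≤
      ∑ y ∈ Aᶜ, (lrpLaw d N β).real (adjEvent S y) := by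
  classical
  have hR' : (2 : ℝ) ≤ R := by exact_mod_cast hR
  have hSc : (S.card : ℝ) ≤ A.card := by exact_mod_cast Finset.card_le_card hSA
  have hS1 : (1 : ℝ) ≤ S.card := by exact_mod_cast hS.card_pos
  have hRβ : β ≤ (R : ℝ) ^ d := by nlinarith
  have hRd : (0 : ℝ) < (R : ℝ) ^ d := by positivity
  have hAβ : A.card * (β / (R : ℝ) ^ d) ≤ 1 := by
    rw [mul_div_assoc', div_le_one hRd]
    linarith
  calc 1 / 4 * (β / 2 * (1 / (d : ℝ) ^ d * Real.log (N / (2 * R))) - 1) * S.card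
      = 1 / 4 * ∑ x ∈ S, (β / 2 * (1 / (d : ℝ) ^ d * Real.log (N / (2 * R))) - 1) := by
        simp only [Finset.sum_const, nsmul_eq_mul]
        ring
    _ ≤ 1 / 4 * ∑ x ∈ S, ∑ y ∈ Aᶜ.filter (fun y => R ≤ l1Dist x y), connProb β s(x, y) := by
        gcongr with x hx
        have h1 : β / 2 * (1 / (d : ℝ) ^ d * Real.log (N / (2 * R))) ≤
            ∑ y ∈ Finset.univ.filter (fun y => R ≤ l1Dist x y), connProb β s(x, y) := by
          refine (mul_le_mul_of_nonneg_left
            (le_sum_one_div_l1Dist hd hN (by omega : 1 ≤ R) x) (by positivity)).trans ?_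
          rw [Finset.mul_sum]
          exact Finset.sum_le_sum fun y hy =>
            le_connProb hβ (by omega) hRβ (Finset.mem_filter.1 hy).2
        have h2 : ∑ y ∈ A.filter (fun y => R ≤ l1Dist x y), connProb β s(x, y) ≤ 1 := by
          refine (Finset.sum_le_card_nsmul _ _ (β / (R : ℝ) ^ d) fun y hy =>
            connProb_le_of_le hβ hR (Finset.mem_filter.1 hy).2).trans ?_
          rw [nsmul_eq_mul]
          refine le_trans ?_ hAβ
          gcongr
          exact Finset.filter_subset _ _
        have h3 : ∑ y ∈ Finset.univ.filter (fun y => R ≤ l1Dist x y), connProb β s(x, y) =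
            ∑ y ∈ A.filter (fun y => R ≤ l1Dist x y), connProb β s(x, y) +
            ∑ y ∈ Aᶜ.filter (fun y => R ≤ l1Dist x y), connProb β s(x, y) := by
          simp only [Finset.sum_filter]
          exact (Finset.sum_add_sum_compl A _).symm
        linarith
    _ = ∑ y ∈ Aᶜ, 1 / 4 * ∑ x ∈ S.filter (fun x => R ≤ l1Dist x y), connProb β s(x, y) := by
        simp only [Finset.sum_filter]
        rw [← Finset.mul_sum, Finset.sum_comm]
    _ ≤ _ := by
        refine Finset.sum_le_sum fun y hy => ?_
        have hyS : y ∉ S.filter (fun x => R ≤ l1Dist x y) := fun h =>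
          Finset.mem_compl.1 hy (hSA (Finset.mem_filter.1 h).1)
        refine (le_lrpLaw_adjEvent hβ hyS ?_).trans
          (measureReal_mono (adjEvent_mono (Finset.filter_subset _ _) y))
        refine (Finset.sum_le_card_nsmul _ _ (β / (R : ℝ) ^ d) fun x hx =>
            connProb_le_of_le hβ hR (Finset.mem_filter.1 hx).2).trans ?_
        rw [nsmul_eq_mul]
        refine le_trans ?_ hAβ
        gcongr
        exact (Finset.filter_subset _ _).trans hSA

/-- The sites outside `A` that are adjacent to a site of `S`. -/
def newSites {d N : ℕ} (A S : Finset (Site d N)) (ω : Config d N) : Set (Site d N) :=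
  {y | y ∉ A ∧ ∃ x ∈ S, (lrpGraph ω).Adj x y}

theorem ncard_newSites {d N : ℕ} (A S : Finset (Site d N)) (ω : Config d N) :
    ((newSites A S ω).ncard : ℝ) =
      ∑ y ∈ Aᶜ, (adjEvent S y).indicator (fun _ => (1 : ℝ)) ω := by
  classical
  have h : newSites A S ω = ((Aᶜ.filter fun y => ω ∈ adjEvent S y : Finset _) : Set _) := by
    ext y
    rw [Finset.mem_coe, Finset.mem_filter, Finset.mem_compl]
    rfl
  rw [h, Set.ncard_coe_finset, Finset.card_filter]
  push_cast
  refine Finset.sum_congr rfl fun y _ => ?_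
  rw [Set.indicator_apply]

/-- One step of the exploration fails with exponentially small probability. -/
theorem lrpLaw_newSites_le {d N : ℕ} {β a b : ℝ} {S A : Finset (Site d N)} (hSA : S ⊆ A)
    (ha : 0 ≤ a)
    (hlow : 4 * a * S.card ≤ ∑ y ∈ Aᶜ, (lrpLaw d N β).real (adjEvent S y))
    (hup : 4 * ∑ y ∈ Aᶜ, (lrpLaw d N β).real (adjEvent S y) ≤ b * S.card) :
    (lrpLaw d N β).real {ω | ¬ (a * S.card ≤ ((newSites A S ω).ncard : ℝ) ∧
      ((newSites A S ω).ncard : ℝ) ≤ b * S.card)} ≤ 2 * Real.exp (-(a * S.card)) := by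
  classical
  set Q := ∑ y ∈ Aᶜ, (lrpLaw d N β).real (adjEvent S y) with hQ
  set Z : Config d N → ℝ := fun ω => ∑ y ∈ Aᶜ, (adjEvent S y).indicator (fun _ => (1 : ℝ)) ω
    with hZ
  have haS : 0 ≤ a * S.card := by positivity
  have hmgf : ∀ t, mgf Z (lrpLaw d N β) t ≤ Real.exp ((Real.exp t - 1) * Q) := fun t =>
    mgf_sum_indicator_le _ (adjEvent S) (pairsTo S) Aᶜ (fun y _ => dependsOn_adjEvent S y)
      (pairwiseDisjoint_pairsTo hSA) t
  have h1 : (lrpLaw d N β).real {ω | Z ω ≤ a * S.card} ≤ Real.exp (-(a * S.card)) := by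
    refine (measure_le_le_exp_mul_mgf (t := -1) _ (by norm_num) Integrable.of_finite).trans ?_
    refine (mul_le_mul_of_nonneg_left (hmgf _) (Real.exp_pos _).le).trans ?_
    rw [← Real.exp_add]
    refine Real.exp_le_exp.2 ?_
    -- The exponent is at most `a |S| - Q / 2`, and `Q ≥ 4 a |S|`.
    nlinarith [exp_neg_one_sub_one_le]
  have h2 : (lrpLaw d N β).real {ω | b * S.card ≤ Z ω} ≤ Real.exp (-(a * S.card)) := by
    refine (measure_ge_le_exp_mul_mgf (t := 1) _ (by norm_num) Integrable.of_finite).trans ?_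
    refine (mul_le_mul_of_nonneg_left (hmgf _) (Real.exp_pos _).le).trans ?_
    rw [← Real.exp_add]
    refine Real.exp_le_exp.2 ?_
    -- The exponent is at most `2 Q - b |S| ≤ -2 Q`, again by the two bounds on `Q`.
    nlinarith [exp_one_sub_one_le_two]
  have hsub : {ω | ¬ (a * S.card ≤ ((newSites A S ω).ncard : ℝ) ∧
      ((newSites A S ω).ncard : ℝ) ≤ b * S.card)} ⊆
      {ω | Z ω ≤ a * S.card} ∪ {ω | b * S.card ≤ Z ω} := by
    intro ω hω
    simp only [Set.mem_ofPred_eq, ncard_newSites, not_and_or, not_le] at hω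
    exact hω.imp le_of_lt le_of_lt
  refine (measureReal_mono hsub).trans ((measureReal_union_le _ _).trans ?_)
  linarith

theorem dependsOn_newSites {d N : ℕ} (A S : Finset (Site d N)) :
    DependsOn (newSites A S) {e : SitePair d N | ∃ x ∈ S, ∃ y ∉ A, e.1 = s(x, y)} := by
  intro ω ω' h
  ext y
  refine and_congr_right fun hy => ?_
  exact iff_of_eq (dependsOn_adjEvent S y fun e ⟨x, hx, he⟩ => h e ⟨x, hx, y, hy, he⟩)

/-! ### Growth of the expansions -/

/-- The event that the exploration from `U` has reached the sites `A` after `k` steps, those of `S`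
in the last step. -/
def exploredEvent {d N : ℕ} (U : Set (Site d N)) (k : ℕ) (A S : Finset (Site d N)) :
    Set (Config d N) :=
  {ω | expansion (lrpGraph ω) U k = A ∧ expansionBoundary (lrpGraph ω) U k = S}

/-- On this event the pairs between `S` and `Aᶜ` have not influenced the exploration, by
`expansion_congr`. With `A` and `S` fixed, the set of these pairs is deterministic, so independence
applies without conditioning. -/
theorem dependsOn_exploredEvent {d N : ℕ} (U : Set (Site d N)) (k : ℕ)
    (A S : Finset (Site d N)) :
    DependsOn (· ∈ exploredEvent U k A S)
      {e : SitePair d N | ∃ x ∈ S, ∃ y ∉ A, e.1 = s(x, y)}ᶜ := by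
  have key : ∀ ω ω' : Config d N,
      (∀ e ∈ {e : SitePair d N | ∃ x ∈ S, ∃ y ∉ A, e.1 = s(x, y)}ᶜ, ω e = ω' e) →
      ω ∈ exploredEvent U k A S → ω' ∈ exploredEvent U k A S := by
    rintro ω ω' h ⟨h1, h2⟩
    have hj := expansion_congr (lrpGraph ω) (lrpGraph ω') U k (by
      intro x y hxy hyx
      rw [h1, h2] at hxy hyx
      rw [lrpGraph_adj, lrpGraph_adj]
      refine exists_congr fun hd => ?_
      rw [h ⟨s(x, y), hd⟩]
      rintro ⟨u, hu, v, hv, he⟩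
      rcases Sym2.eq_iff.1 he with ⟨rfl, rfl⟩ | ⟨rfl, rfl⟩
      · exact hxy ⟨hu, hv⟩
      · exact hyx ⟨hu, hv⟩)
    exact ⟨(hj k le_rfl).symm.trans h1, (expansionBoundary_eq_of_forall _ _ U k hj).symm.trans h2⟩
  intro ω ω' h
  exact propext ⟨key ω ω' h, key ω' ω fun e he => (h e he).symm⟩

/-- If every admissible step fails with probability at most `ε`, then so does the step that starts
from the explored sites. -/
theorem lrpLaw_exploration_step_le {d N : ℕ} {β ε : ℝ} (hε : 0 ≤ ε) (U : Set (Site d N)) (k : ℕ)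
    (P : Finset (Site d N) → Finset (Site d N) → Prop)
    (Q : Finset (Site d N) → Finset (Site d N) → Set (Site d N) → Prop)
    (h : ∀ A S, P A S → (lrpLaw d N β).real {ω | Q A S (newSites A S ω)} ≤ ε) :
    (lrpLaw d N β).real {ω | ∃ A S, P A S ∧ ω ∈ exploredEvent U k A S ∧
      Q A S (newSites A S ω)} ≤ ε := by
  classical
  set I : Finset (Finset (Site d N) × Finset (Site d N)) :=
    Finset.univ.filter fun p => P p.1 p.2 with hI
  have hset : {ω : Config d N | ∃ A S, P A S ∧ ω ∈ exploredEvent U k A S ∧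
      Q A S (newSites A S ω)} =
      ⋃ p ∈ I, (exploredEvent U k p.1 p.2 ∩ {ω | Q p.1 p.2 (newSites p.1 p.2 ω)}) := by
    ext ω
    simp [hI, and_left_comm]
  have hind : ∀ p : Finset (Site d N) × Finset (Site d N),
      (lrpLaw d N β).real (exploredEvent U k p.1 p.2 ∩ {ω | Q p.1 p.2 (newSites p.1 p.2 ω)}) =
      (lrpLaw d N β).real (exploredEvent U k p.1 p.2) *
        (lrpLaw d N β).real {ω | Q p.1 p.2 (newSites p.1 p.2 ω)} := by
    rintro ⟨A, S⟩
    have hdep : DependsOn (fun ω => Q A S (newSites A S ω))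
        {e : SitePair d N | ∃ x ∈ S, ∃ y ∉ A, e.1 = s(x, y)} := by
      intro ω ω' hω
      exact congrArg (Q A S) (dependsOn_newSites A S hω)
    have hif : IndepFun (fun ω => ω ∈ exploredEvent U k A S)
        (fun ω => Q A S (newSites A S ω)) (lrpLaw d N β) :=
      indepFun_pi_of_dependsOn _ (dependsOn_exploredEvent U k A S) hdep disjoint_compl_left
    have := hif.measure_inter_preimage_eq_mul {True} {True} (MeasurableSet.singleton _)
      (MeasurableSet.singleton _)
    have e1 : (fun ω => ω ∈ exploredEvent U k A S) ⁻¹' {True} = exploredEvent U k A S := by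
      ext ω; simp
    have e2 : (fun ω => Q A S (newSites A S ω)) ⁻¹' {True} =
        {ω | Q A S (newSites A S ω)} := by
      ext ω; simp
    rw [e1, e2] at this
    simp only [measureReal_def, this, ENNReal.toReal_mul]
  -- The explored pair `(A, S)` is determined by the configuration, so the probabilities of these
  -- events sum to at most `1`.
  have hdisj : (I : Set (Finset (Site d N) × Finset (Site d N))).PairwiseDisjoint
      (fun p => exploredEvent U k p.1 p.2) := by
    intro p _ q _ hpq
    refine Set.disjoint_left.2 fun ω hp hq => hpq ?_
    exact Prod.ext (Finset.coe_injective (hp.1.symm.trans hq.1))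
      (Finset.coe_injective (hp.2.symm.trans hq.2))
  rw [hset]
  calc _ ≤ ∑ p ∈ I, (lrpLaw d N β).real
        (exploredEvent U k p.1 p.2 ∩ {ω | Q p.1 p.2 (newSites p.1 p.2 ω)}) :=
        measureReal_biUnion_finset_le _ _
    _ ≤ ∑ p ∈ I, (lrpLaw d N β).real (exploredEvent U k p.1 p.2) * ε := by
        refine Finset.sum_le_sum fun p hp => ?_
        rw [hind]
        exact mul_le_mul_of_nonneg_left (h _ _ (Finset.mem_filter.1 hp).2) measureReal_nonneg
    _ = (lrpLaw d N β).real (⋃ p ∈ I, exploredEvent U k p.1 p.2) * ε := by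
        rw [measureReal_biUnion_finset hdisj fun p _ => (Set.toFinite _).measurableSet,
          Finset.sum_mul]
    _ ≤ 1 * ε := by
        gcongr
        exact measureReal_le_one
    _ = ε := one_mul ε

theorem ncard_expansion_le {V : Type*} [Finite V] (G : SimpleGraph V) (U : Set V) {b : ℝ}
    (hb : 0 ≤ b) (m : ℕ)
    (h : ∀ j ≤ m, ((expansionBoundary G U j).ncard : ℝ) ≤ b ^ j * U.ncard) :
    ((expansion G U m).ncard : ℝ) ≤ (1 + b) ^ m * U.ncard := by
  induction m with
  | zero => simp [expansion_zero]
  | succ m ih =>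
    have h1 := ih fun j hj => h j (by omega)
    have h2 := h (m + 1) le_rfl
    have h3 : ((expansion G U (m + 1)).ncard : ℝ) ≤
        (expansion G U m).ncard + (expansionBoundary G U (m + 1)).ncard := by
      rw [expansion_succ_eq]
      exact_mod_cast Set.ncard_union_le _ _
    have h4 : b ^ m ≤ (1 + b) ^ m := by
      gcongr
      linarith
    have h5 : b ^ (m + 1) * U.ncard ≤ b * (1 + b) ^ m * U.ncard := by
      rw [pow_succ, mul_comm (b ^ m)]
      gcongr
    calc _ ≤ (1 + b) ^ m * U.ncard + b * (1 + b) ^ m * U.ncard := by linarith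
      _ = _ := by ring

/-- Union bound over the steps. While the bounds hold, `1 ≤ a` keeps each layer at least as large as
`U`, so one `ε` serves all steps, and `hcap` keeps the explored set within the size allowed by
`hstep`. -/
theorem lrpLaw_growth_le {d N : ℕ} {β a b ε cap : ℝ} (ha : 1 ≤ a) (hb : 0 ≤ b) (hε : 0 ≤ ε)
    (U : Set (Site d N))
    (hstep : ∀ A S : Finset (Site d N), S ⊆ A → U.ncard ≤ S.card → (A.card : ℝ) ≤ cap →
      (lrpLaw d N β).real {ω | ¬ (a * S.card ≤ ((newSites A S ω).ncard : ℝ) ∧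
        ((newSites A S ω).ncard : ℝ) ≤ b * S.card)} ≤ ε)
    (m : ℕ) (hcap : (1 + b) ^ m * U.ncard ≤ cap) :
    (lrpLaw d N β).real {ω | ¬ ∀ j ≤ m,
      a ^ j * U.ncard ≤ ((expansionBoundary (lrpGraph ω) U j).ncard : ℝ) ∧
      ((expansionBoundary (lrpGraph ω) U j).ncard : ℝ) ≤ b ^ j * U.ncard} ≤ m * ε := by
  classical
  induction m with
  | zero =>
    simp [expansionBoundary, expansion_zero]
  | succ m ih =>
    have hcap' : (1 + b) ^ m * U.ncard ≤ cap := by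
      refine le_trans ?_ hcap
      gcongr
      · linarith
      · omega
    have ih := ih hcap'
    have hs := lrpLaw_exploration_step_le (β := β) hε U m
      (fun A S => S ⊆ A ∧ U.ncard ≤ S.card ∧ (A.card : ℝ) ≤ cap)
      (fun A S T => ¬ (a * S.card ≤ (T.ncard : ℝ) ∧ (T.ncard : ℝ) ≤ b * S.card))
      (fun A S h => hstep A S h.1 h.2.1 h.2.2)
    have hsub : {ω : Config d N | ¬ ∀ j ≤ m + 1,
        a ^ j * U.ncard ≤ ((expansionBoundary (lrpGraph ω) U j).ncard : ℝ) ∧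
        ((expansionBoundary (lrpGraph ω) U j).ncard : ℝ) ≤ b ^ j * U.ncard} ⊆
        {ω | ¬ ∀ j ≤ m,
          a ^ j * U.ncard ≤ ((expansionBoundary (lrpGraph ω) U j).ncard : ℝ) ∧
          ((expansionBoundary (lrpGraph ω) U j).ncard : ℝ) ≤ b ^ j * U.ncard} ∪
        {ω | ∃ A S, (S ⊆ A ∧ U.ncard ≤ S.card ∧ (A.card : ℝ) ≤ cap) ∧
          ω ∈ exploredEvent U m A S ∧ ¬ (a * S.card ≤ ((newSites A S ω).ncard : ℝ) ∧
            ((newSites A S ω).ncard : ℝ) ≤ b * S.card)} := by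
      intro ω hω
      rw [Set.mem_union]
      by_contra hcon
      rw [not_or, Set.mem_ofPred_eq, not_not] at hcon
      obtain ⟨hgood, hno⟩ := hcon
      refine hω fun j hj => ?_
      rcases Nat.lt_or_ge m j with hmj | hmj
      swap
      · exact hgood j hmj
      obtain rfl : j = m + 1 := by omega
      set A := (expansion (lrpGraph ω) U m).toFinset with hA
      set S := (expansionBoundary (lrpGraph ω) U m).toFinset with hS
      have hAc : (expansion (lrpGraph ω) U m).ncard = A.card := Set.ncard_eq_toFinset_card' _
      have hSc : (expansionBoundary (lrpGraph ω) U m).ncard = S.card :=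
        Set.ncard_eq_toFinset_card' _
      have hnew : expansionBoundary (lrpGraph ω) U (m + 1) = newSites A S ω := by
        rw [expansionBoundary_succ_eq, newSites]
        simp only [hA, hS, Set.mem_toFinset]
      have hm := hgood m le_rfl
      rw [hSc] at hm
      have hstep' : a * S.card ≤ ((newSites A S ω).ncard : ℝ) ∧
          ((newSites A S ω).ncard : ℝ) ≤ b * S.card := by
        by_contra hbad
        refine hno ⟨A, S, ⟨?_, ?_, ?_⟩, ⟨?_, ?_⟩, hbad⟩
        · exact Set.toFinset_subset_toFinset.2 (expansionBoundary_subset _ _ _)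
        · have h1 : (U.ncard : ℝ) ≤ a ^ m * U.ncard :=
            le_mul_of_one_le_left (by positivity) (one_le_pow₀ ha)
          exact_mod_cast h1.trans hm.1
        · rw [← hAc]
          exact (ncard_expansion_le _ U hb m fun j hj => (hgood j hj).2).trans hcap'
        · exact (Set.coe_toFinset _).symm
        · exact (Set.coe_toFinset _).symm
      rw [hnew]
      constructor
      · refine le_trans ?_ hstep'.1
        rw [pow_succ, mul_comm (a ^ m), mul_assoc]
        gcongr
        exact hm.1
      · refine hstep'.2.trans ?_
        rw [pow_succ, mul_comm (b ^ m), mul_assoc]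
        gcongr
        exact hm.2
    refine (measureReal_mono hsub).trans ((measureReal_union_le _ _).trans ?_)
    push_cast
    linarith

/-! ### Asymptotics and the main theorem -/

open Filter in
theorem tendsto_log_natCast : Tendsto (fun N : ℕ => Real.log (N : ℝ)) atTop atTop :=
  Real.tendsto_log_atTop.comp tendsto_natCast_atTop_atTop

open Filter in
theorem tendsto_log_log_natCast :
    Tendsto (fun N : ℕ => Real.log (Real.log (N : ℝ))) atTop atTop :=
  Real.tendsto_log_atTop.comp tendsto_log_natCast

theorem pow_le_exp_mul_div_log {c L X : ℝ} {m : ℕ} (hc : 1 ≤ c * L) (hc0 : 0 < c)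
    (hl : 0 < Real.log L) (hL : 0 < L) (hm : (m : ℝ) ≤ X / Real.log L) :
    (c * L) ^ m ≤ Real.exp (X + X * Real.log c / Real.log L) := by
  have h1 : (c * L) ^ m = Real.exp (m * Real.log (c * L)) := by
    rw [Real.exp_nat_mul, Real.exp_log (by positivity)]
  rw [h1]
  refine Real.exp_le_exp.2 ((mul_le_mul_of_nonneg_right hm (Real.log_nonneg hc)).trans ?_)
  rw [Real.log_mul hc0.ne' hL.ne']
  refine le_of_eq ?_
  field_simp
  ring

/-- Rounding `X / log L` down loses at most one factor `c L`, whence the terms `- log L - log c`. -/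
theorem exp_le_pow_of_sub_one_le {c L X : ℝ} {m : ℕ} (hc : 1 ≤ c * L) (hc0 : 0 < c)
    (hl : 0 < Real.log L) (hL : 0 < L) (hm : X / Real.log L - 1 ≤ m) :
    Real.exp (X + X * Real.log c / Real.log L - Real.log L - Real.log c) ≤ (c * L) ^ m := by
  have h1 : (c * L) ^ m = Real.exp (m * Real.log (c * L)) := by
    rw [Real.exp_nat_mul, Real.exp_log (by positivity)]
  rw [h1]
  refine Real.exp_le_exp.2 (le_trans ?_ (mul_le_mul_of_nonneg_right hm (Real.log_nonneg hc)))
  rw [Real.log_mul hc0.ne' hL.ne']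
  refine le_of_eq ?_
  field_simp
  ring

/-- The constant of the upper bound. -/
noncomputable def upperConst (d : ℕ) (β : ℝ) : ℝ := 16 * d * 3 ^ d * (1 + β)

/-- The constant of the lower bound. -/
noncomputable def lowerConst (d : ℕ) (β α : ℝ) : ℝ :=
  β / 2 * (1 / (d : ℝ) ^ d) * ((1 - α) / 4) / 32

theorem one_le_upperConst {d : ℕ} (hd : 1 ≤ d) {β : ℝ} (hβ : 0 < β) : 1 ≤ upperConst d β := by
  have h1 : (1 : ℝ) ≤ d := by exact_mod_cast hd
  have h2 : (1 : ℝ) ≤ 3 ^ d := one_le_pow₀ (by norm_num)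
  have h3 : (1 : ℝ) ≤ d * 3 ^ d := by nlinarith
  have h4 : upperConst d β = 16 * (d * 3 ^ d) * (1 + β) := by
    unfold upperConst
    ring
  rw [h4]
  nlinarith

theorem lowerConst_pos {d : ℕ} (hd : 1 ≤ d) {β α : ℝ} (hβ : 0 < β) (hα : α < 1) :
    0 < lowerConst d β α := by
  have h1 : (0 : ℝ) < d := by exact_mod_cast hd
  have h2 : 0 < 1 - α := by linarith
  unfold lowerConst
  positivity

/-- The exploration step, for sets `A` of size at most `N ^ (γ d) / β` with `γ = (1 + α) / 2`. -/
theorem lrpLaw_step_le {d N : ℕ} (hd : 1 ≤ d) {β α : ℝ} (hβ : 0 < β) (hα0 : 0 < α) (hα : α < 1)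
    (hL : 1 ≤ Real.log N) (hc : 1 ≤ lowerConst d β α * Real.log N)
    (h4 : Real.log 4 ≤ (1 - α) / 4 * Real.log N) {A S : Finset (Site d N)} (hSA : S ⊆ A)
    (hS : S.Nonempty)
    (hA : (A.card : ℝ) ≤ Real.exp ((1 + α) / 2 * d * Real.log N) / β) :
    (lrpLaw d N β).real {ω | ¬ (lowerConst d β α * Real.log N * S.card ≤
        ((newSites A S ω).ncard : ℝ) ∧
      ((newSites A S ω).ncard : ℝ) ≤ upperConst d β * Real.log N * S.card)} ≤
      2 * Real.exp (-(lowerConst d β α * Real.log N * S.card)) := by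
  set L := Real.log N with hLdef
  have hN : 1 ≤ N := by
    rcases Nat.eq_zero_or_pos N with h | h
    · rw [hLdef, h] at hL
      norm_num at hL
    · exact h
  have hN0 : (0 : ℝ) < N := by exact_mod_cast hN
  have hS0 : (0 : ℝ) < S.card := by exact_mod_cast hS.card_pos
  have hd0 : (0 : ℝ) < d := by exact_mod_cast hd
  -- This is `N ^ ((1 + α) / 2)`. The cutoff `R` is its ceiling, so `log (N / (2 R))` is at least
  -- `(1 - α) / 2 * L - log 4`, and `h4` absorbs the last term.
  set ρ := Real.exp ((1 + α) / 2 * L) with hρ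
  have hρ1 : 1 < ρ := Real.one_lt_exp_iff.2 (by nlinarith)
  set R := ⌈ρ⌉₊ with hR
  have hρR : ρ ≤ R := Nat.le_ceil ρ
  have hR2 : 2 ≤ R := by
    have : (1 : ℝ) < R := lt_of_lt_of_le hρ1 hρR
    exact_mod_cast this
  have hRρ : (R : ℝ) ≤ 2 * ρ := by
    have := Nat.ceil_lt_add_one (a := ρ) (by linarith)
    linarith
  have hR0 : (0 : ℝ) < R := by linarith
  have hlog : (1 - α) / 4 * L ≤ Real.log (N / (2 * R)) := by
    rw [Real.log_div hN0.ne' (by positivity)]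
    have h5 : Real.log (2 * R) ≤ Real.log 4 + (1 + α) / 2 * L := by
      have h6 : (1 + α) / 2 * L = Real.log ρ := (Real.log_exp _).symm
      rw [h6, ← Real.log_mul (by norm_num) (by positivity)]
      exact Real.log_le_log (by positivity) (by linarith)
    rw [← hLdef]
    linarith
  have hAR : β * A.card ≤ (R : ℝ) ^ d := by
    have h5 : Real.exp ((1 + α) / 2 * d * L) = ρ ^ d := by
      rw [hρ, ← Real.exp_nat_mul]
      congr 1
      ring
    rw [h5, le_div_iff₀ hβ] at hA
    calc β * A.card = A.card * β := mul_comm _ _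
      _ ≤ ρ ^ d := hA
      _ ≤ _ := by gcongr
  refine lrpLaw_newSites_le hSA (by linarith) ?_ ?_
  · refine le_trans ?_ (le_sum_adjEvent hd hN hβ.le hR2 hSA hS hAR)
    refine mul_le_mul_of_nonneg_right ?_ hS0.le
    have h7 : 32 * lowerConst d β α * L ≤
        β / 2 * (1 / (d : ℝ) ^ d * Real.log (N / (2 * R))) := by
      calc 32 * lowerConst d β α * L = β / 2 * (1 / (d : ℝ) ^ d * ((1 - α) / 4 * L)) := by
            unfold lowerConst
            ring
        _ ≤ _ := by gcongr
    linarith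
  · refine (mul_le_mul_of_nonneg_left (sum_adjEvent_le hβ.le hSA) (by norm_num)).trans ?_
    rw [← hLdef, ← mul_assoc]
    refine mul_le_mul_of_nonneg_right ?_ hS0.le
    unfold upperConst
    have h8 : 0 ≤ (1 + β) * (d * 3 ^ d) := by positivity
    nlinarith

/-- The bounds on `|∂B_m|`, with explicit constants, for all large `N`. -/
theorem eventually_boundaryRatio {d : ℕ} (hd : 1 ≤ d) {β α : ℝ} (hβ : 0 < β) (hα0 : 0 < α)
    (hα : α < 1) (K : ℕ) :
    ∀ᶠ N : ℕ in Filter.atTop, ∀ B₀ : Set (Site d N), B₀.Nonempty → B₀.ncard ≤ K →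
      ∀ m : ℕ, (m : ℝ) ≤ α * d * Real.log N / Real.log (Real.log N) →
        1 - 2 * Real.exp (-(lowerConst d β α / 2 * Real.log N * (B₀.ncard : ℝ))) ≤
          (lrpLaw d N β).real {ω | (lowerConst d β α * Real.log N) ^ m ≤ boundaryRatio B₀ m ω ∧
            boundaryRatio B₀ m ω ≤ (upperConst d β * Real.log N) ^ m} := by
  classical
  have hd0 : (1 : ℝ) ≤ d := by exact_mod_cast hd
  have hc0 := lowerConst_pos hd hβ hα
  have hC1 := one_le_upperConst hd hβ
  have hL := tendsto_log_natCast
  have hl := tendsto_log_log_natCast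
  -- The number of steps is at most `d log N`; absorbing this factor of the union bound costs half
  -- of the exponent.
  have e4 : ∀ᶠ N : ℕ in Filter.atTop, (d : ℝ) * Real.log N ≤
      Real.exp (lowerConst d β α / 2 * Real.log N) := by
    have h1 : Filter.Tendsto (fun N : ℕ => lowerConst d β α / 2 * Real.log N) Filter.atTop
        Filter.atTop := hL.const_mul_atTop (by positivity)
    have h2 := (Real.tendsto_exp_div_pow_atTop 1).comp h1
    filter_upwards [h2.eventually_ge_atTop (d / (lowerConst d β α / 2)),
      hL.eventually_ge_atTop 1] with N h3 h4
    simp only [Function.comp_apply, pow_one] at h3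
    rw [div_le_div_iff₀ (by positivity) (by positivity)] at h3
    have h5 : 0 < lowerConst d β α / 2 := by positivity
    refine le_of_mul_le_mul_right ?_ h5
    linarith
  have e5 : ∀ᶠ N : ℕ in Filter.atTop, β * K ≤ Real.exp ((1 - α) / 4 * d * Real.log N) := by
    have h1 : Filter.Tendsto (fun N : ℕ => (1 - α) / 4 * d * Real.log N) Filter.atTop
        Filter.atTop := hL.const_mul_atTop (by
          have : 0 < 1 - α := by linarith
          positivity)
    exact (Real.tendsto_exp_atTop.comp h1).eventually_ge_atTop _
  have e6 : ∀ᶠ N : ℕ in Filter.atTop, α * Real.log (2 * upperConst d β) ≤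
      (1 - α) / 4 * Real.log (Real.log N) :=
    (hl.const_mul_atTop (by linarith : 0 < (1 - α) / 4)).eventually_ge_atTop _
  filter_upwards [hL.eventually_ge_atTop 1, hl.eventually_ge_atTop 1,
    (hL.const_mul_atTop hc0).eventually_ge_atTop 1,
    (hL.const_mul_atTop (by linarith : 0 < (1 - α) / 4)).eventually_ge_atTop (Real.log 4),
    e4, e5, e6] with N h1 h2 h3 h4 h5 h6 h7
  intro B₀ hB₀ hK m hm
  set L := Real.log N with hLdef
  set c := lowerConst d β α with hcdef
  set C := upperConst d β with hCdef
  have hB1 : 1 ≤ B₀.ncard := (Set.ncard_pos).2 hB₀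
  have hB : (1 : ℝ) ≤ B₀.ncard := by exact_mod_cast hB1
  have hKr : (B₀.ncard : ℝ) ≤ K := by exact_mod_cast hK
  have hCL : 1 ≤ C * L := by nlinarith
  -- The exponent `(1 + α) / 2` is split as `α + (1 - α) / 4 + (1 - α) / 4`: the main growth, the
  -- factor `(2 C) ^ m`, and `β K`.
  have hcap : (1 + C * L) ^ m * B₀.ncard ≤ Real.exp ((1 + α) / 2 * d * L) / β := by
    rw [le_div_iff₀ hβ]
    have h8 : (1 + C * L) ^ m ≤ (2 * C * L) ^ m := by
      gcongr
      linarith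
    have h9 := h8.trans (pow_le_exp_mul_div_log (c := 2 * C) (by linarith) (by linarith)
      (by linarith) (by linarith) hm)
    have h10 : α * d * L + α * d * L * Real.log (2 * C) / Real.log L ≤
        α * d * L + (1 - α) / 4 * d * L := by
      gcongr
      rw [div_le_iff₀ (by linarith)]
      have : 0 ≤ (d : ℝ) * L := by positivity
      nlinarith
    calc (1 + C * L) ^ m * B₀.ncard * β
        ≤ Real.exp (α * d * L + (1 - α) / 4 * d * L) * (K * β) := by
          rw [mul_assoc]
          gcongr
          exact h9.trans (Real.exp_le_exp.2 h10)
      _ ≤ Real.exp (α * d * L + (1 - α) / 4 * d * L) * Real.exp ((1 - α) / 4 * d * L) := by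
          gcongr
          linarith
      _ = _ := by
          rw [← Real.exp_add]
          congr 1
          ring
  have hgrow := lrpLaw_growth_le (β := β) (a := c * L) (b := C * L)
    (ε := 2 * Real.exp (-(c * L * B₀.ncard))) h3 (by linarith) (by positivity) B₀ (by
      intro A S hSA hS hA
      have hSne : S.Nonempty := Finset.card_pos.1 (by omega)
      refine (lrpLaw_step_le hd hβ hα0 hα h1 h3 h4 hSA hSne hA).trans ?_
      have : (B₀.ncard : ℝ) ≤ S.card := by exact_mod_cast hS
      gcongr) m hcap
  have hmexp : (m : ℝ) ≤ Real.exp (c / 2 * L * B₀.ncard) := by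
    have h8 : α * d * L / Real.log L ≤ d * L := by
      rw [div_le_iff₀ (by linarith)]
      have h9 : 0 ≤ (d : ℝ) * L := by positivity
      nlinarith
    refine (hm.trans h8).trans (h5.trans (Real.exp_le_exp.2 ?_))
    have h9 : 0 ≤ c / 2 * L := by positivity
    nlinarith
  have hfail : m * (2 * Real.exp (-(c * L * B₀.ncard))) ≤
      2 * Real.exp (-(c / 2 * L * B₀.ncard)) := by
    calc m * (2 * Real.exp (-(c * L * B₀.ncard)))
        ≤ Real.exp (c / 2 * L * B₀.ncard) * (2 * Real.exp (-(c * L * B₀.ncard))) := by gcongr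
      _ = 2 * (Real.exp (c / 2 * L * B₀.ncard) * Real.exp (-(c * L * B₀.ncard))) := by ring
      _ = _ := by
        rw [← Real.exp_add]
        congr 2
        ring
  set F := {ω : Config d N | ¬ ∀ j ≤ m,
      (c * L) ^ j * B₀.ncard ≤ ((expansionBoundary (lrpGraph ω) B₀ j).ncard : ℝ) ∧
      ((expansionBoundary (lrpGraph ω) B₀ j).ncard : ℝ) ≤ (C * L) ^ j * B₀.ncard} with hF
  have hcompl := probReal_compl_eq_one_sub (μ := lrpLaw d N β) (Set.toFinite F).measurableSet
  have hsub : Fᶜ ⊆ {ω | (c * L) ^ m ≤ boundaryRatio B₀ m ω ∧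
      boundaryRatio B₀ m ω ≤ (C * L) ^ m} := by
    intro ω hω
    rw [Set.mem_compl_iff, hF, Set.mem_ofPred_eq, not_not] at hω
    have h8 := hω m le_rfl
    rw [Set.mem_ofPred_eq, boundaryRatio, le_div_iff₀ (by linarith), div_le_iff₀ (by linarith)]
    exact h8
  have := measureReal_mono (μ := lrpLaw d N β) hsub
  linarith

theorem mainTheorem2 (d : ℕ) (hd : 1 ≤ d) (β : ℝ) (hβ : 0 < β) :
    (∃ C : ℝ, 0 < C ∧ ∀ α : ℝ, 0 < α → α < 1 →
      ∃ c₁ c₂ : ℝ, 0 < c₁ ∧ 0 < c₂ ∧ ∀ K : ℕ, ∃ Nstar : ℕ, ∀ N : ℕ, Nstar ≤ N →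
        ∀ B₀ : Set (Site d N), B₀.Nonempty → B₀.ncard ≤ K →
        ∀ m : ℕ, (m : ℝ) ≤ α * d * Real.log N / Real.log (Real.log N) →
          1 - 2 * Real.exp (-(c₂ * Real.log N * (B₀.ncard : ℝ))) ≤
            (lrpLaw d N β).real {ω | (c₁ * Real.log N) ^ m ≤ boundaryRatio B₀ m ω ∧
              boundaryRatio B₀ m ω ≤ (C * Real.log N) ^ m}) ∧
    (∃ C : ℝ, 0 < C ∧ ∀ α : ℝ, 0 < α → α < 1 →
      ∃ c₁ c₂ : ℝ, 0 < c₁ ∧ 0 < c₂ ∧ ∀ K : ℕ, ∃ Nstar : ℕ, ∀ N : ℕ, Nstar ≤ N →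
        ∀ B₀ : Set (Site d N), B₀.Nonempty → B₀.ncard ≤ K →
        ∀ m : ℕ, m = ⌊α * d * Real.log N / Real.log (Real.log N)⌋₊ →
          1 - 2 * (N : ℝ) ^ (-(c₂ * (B₀.ncard : ℝ))) ≤
            (lrpLaw d N β).real {ω |
              (N : ℝ) ^ (α * d * (1 - c₁ / Real.log (Real.log N))) ≤ boundaryRatio B₀ m ω ∧
              boundaryRatio B₀ m ω ≤ (N : ℝ) ^ (α * d * (1 + C / Real.log (Real.log N)))}) := by
  have hC1 := one_le_upperConst hd hβ
  have hd0 : (1 : ℝ) ≤ d := by exact_mod_cast hd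
  constructor
  · refine ⟨upperConst d β, by linarith, fun α hα0 hα => ?_⟩
    have hc0 := lowerConst_pos hd hβ hα
    exact ⟨lowerConst d β α, lowerConst d β α / 2, hc0, by positivity, fun K =>
      Filter.eventually_atTop.1 (eventually_boundaryRatio hd hβ hα0 hα K)⟩
  · have hlogC : 0 ≤ Real.log (upperConst d β) := Real.log_nonneg hC1
    refine ⟨Real.log (upperConst d β) + 1, by linarith, fun α hα0 hα => ?_⟩
    have hc0 := lowerConst_pos hd hβ hα
    -- The summand `1` supplies a factor `exp (α d L / log L)`, with `L = log N`, which pays for the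
    -- factor `c L` lost by the floor.
    refine ⟨|Real.log (lowerConst d β α)| + 1, lowerConst d β α / 2, by positivity,
      by positivity, fun K => Filter.eventually_atTop.1 ?_⟩
    have hL := tendsto_log_natCast
    have hl := tendsto_log_log_natCast
    have e1 : ∀ᶠ N : ℕ in Filter.atTop,
        Real.log (Real.log N) ^ 2 ≤ α / 2 * Real.log N := by
      have h1 := (Real.isLittleO_pow_log_id_atTop (n := 2)).bound
        (by positivity : (0 : ℝ) < α / 2)
      filter_upwards [hL.eventually h1, hL.eventually_ge_atTop 1] with N h2 h3
      simp only [id, Real.norm_eq_abs] at h2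
      rw [abs_of_nonneg (by positivity), abs_of_nonneg (by linarith)] at h2
      exact h2
    filter_upwards [eventually_boundaryRatio hd hβ hα0 hα K, hL.eventually_ge_atTop 1,
      hl.eventually_ge_atTop 1, hl.eventually_ge_atTop |Real.log (lowerConst d β α)|,
      (hL.const_mul_atTop hc0).eventually_ge_atTop 1, e1] with N h0 h1 h2 h3 h4 h5
    intro B₀ hB₀ hK m hm
    set L := Real.log N with hLdef
    set c := lowerConst d β α with hcdef
    set C := upperConst d β with hCdef
    have hN0 : (0 : ℝ) < N := by
      rcases Nat.eq_zero_or_pos N with h | h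
      · rw [hLdef, h] at h1
        norm_num at h1
      · exact_mod_cast h
    have hX : 0 ≤ α * d * L := by positivity
    have hl0 : 0 < Real.log L := by linarith
    have hm1 : (m : ℝ) ≤ α * d * L / Real.log L := by
      rw [hm]
      exact Nat.floor_le (by positivity)
    have hm2 : α * d * L / Real.log L - 1 ≤ m := by
      rw [hm]
      linarith [Nat.lt_floor_add_one (α * d * L / Real.log L)]
    have hrp : ∀ y : ℝ, (N : ℝ) ^ y = Real.exp (L * y) := fun y => Real.rpow_def_of_pos hN0 y
    have hup : (C * L) ^ m ≤ (N : ℝ) ^ (α * d * (1 + (Real.log C + 1) / Real.log L)) := by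
      refine (pow_le_exp_mul_div_log (by nlinarith) (by linarith) hl0 (by linarith) hm1).trans ?_
      rw [hrp]
      refine Real.exp_le_exp.2 ?_
      have : L * (α * d * (1 + (Real.log C + 1) / Real.log L)) =
          α * d * L + α * d * L * Real.log C / Real.log L + α * d * L / Real.log L := by ring
      rw [this]
      have : 0 ≤ α * d * L / Real.log L := by positivity
      linarith
    have hlow : (N : ℝ) ^ (α * d * (1 - (|Real.log c| + 1) / Real.log L)) ≤ (c * L) ^ m := by
      refine le_trans ?_ (exp_le_pow_of_sub_one_le h4 hc0 hl0 (by linarith) hm2)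
      rw [hrp]
      refine Real.exp_le_exp.2 ?_
      have h6 : L * (α * d * (1 - (|Real.log c| + 1) / Real.log L)) =
          α * d * L + α * d * L * Real.log c / Real.log L -
            (α * d * L * (|Real.log c| + Real.log c)) / Real.log L - α * d * L / Real.log L := by
        ring
      have h7 : 0 ≤ (α * d * L * (|Real.log c| + Real.log c)) / Real.log L := by
        have := neg_abs_le (Real.log c)
        have : 0 ≤ |Real.log c| + Real.log c := by linarith
        positivity
      -- Since `log c ≤ log L`, the product of the left side with `log L` is at most `2 (log L) ^
      -- 2`, which `e1` bounds by `α L`.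
      have h8 : Real.log L + Real.log c ≤ α * d * L / Real.log L := by
        rw [le_div_iff₀ hl0]
        have h9 : α * L ≤ α * d * L := by
          have : 0 ≤ α * L := by positivity
          nlinarith
        have h10 := le_abs_self (Real.log c)
        nlinarith
      linarith
    have hprob : 2 * (N : ℝ) ^ (-(c / 2 * (B₀.ncard : ℝ))) =
        2 * Real.exp (-(c / 2 * L * (B₀.ncard : ℝ))) := by
      rw [hrp]
      congr 2
      ring
    rw [hprob]
    exact (h0 B₀ hB₀ hK m hm1).trans (measureReal_mono fun ω hω =>
      ⟨hlow.trans hω.1, hω.2.trans hup⟩)
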